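/- Let $m_1,m_2,p_1,p_2,N,s\ge 1$ be integers, $m=m_1m_2$, $p=p_1p_2$, $s\le p$, and let $\sigma,\sigma_a,r>0$. Let $\mathcal D$ be the set of matrices $D=A\otimes B\in\mathbb R^{m\times p}$ with $A\in\mathbb R^{m_1\times p_1}$, $B\in\mathbb R^{m_2\times p_2}$ whose columns all have Euclidean norm $1$. Fix a reference dictionary $D_0=A_0\otimes B_0$, where $A_0\in\mathbb R^{m_1\times p_1}$ and $B_0\in\mathbb R^{m_2\times p_2}$ have unit-norm columns, and suppose that $D_0$ satisfies $\mathsf{RIP}(s,\frac12)$, that is, $\frac12\|x\|_2^2\le\|D_0x\|_2^2\le\frac32\|x\|_2^2$ for every $x\in\mathbb R^p$ with at most $s$ nonzero entries. Let $\mathcal X(D_0,r)=\{D\in\mathcal D:\|D-D_0\|_F<r\}$. Let $x$ be a zero-mean random vector in $\mathbb R^p$ with square-integrable entries, whose support is uniformly distributed over the $s$-element subsets of $\{1,\dots,p\}$ and which satisfies $\mathbb E[x_Sx_S^T\mid \operatorname{supp}(x)=S]=\sigma_a^2I_s$ for every such subset $S$ (for instance because, given the support, the nonzero entries are i.i.d.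 with mean $0$ and variance $\sigma_a^2$); in particular $\Sigma_x=\frac sp\sigma_a^2I_p$. For $D\in\mathcal X(D_0,r)$ let $Y=(y_1,\dots,y_N)$ consist of $N$ i.i.d. observations of $y=Dx+n$, where $n$ is independent of $x$ and has i.i.d. $\mathcal N(0,\sigma^2)$ entries. The minimax risk is $$\varepsilon^*=\inf_{\widehat D}\ \sup_{D\in\mathcal X(D_0,r)}\mathbb E_Y\|\widehat D(Y)-D\|_F^2 ,$$ the infimum being over all measurable maps $\widehat D$ from the observations to $\mathbb R^{m\times p}$. Let $0<t<1$ and $0<c_1<\frac{t}{8\log 2}$ (natural logarithm), and let $C_1=\frac{(1-t)p}{32r^2}$. If $$\varepsilon^*\le\frac{2p(1-t)}{8}\min\Big\{1,\frac{r^2}{4p}\Big\},$$ then $$\varepsilon^*\ \ge\ \frac{C_1r^2\sigma^2}{Ns\sigma_a^2}\Big(c_1\big(p_1(m_1-1)+p_2(m_2-1)\big)-3\Big).$$ -/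

import Mathlib

open MeasureTheory ProbabilityTheory
open scoped ENNReal NNReal Matrix Kronecker

noncomputable section

namespace KSDict

section Dictionaries

open scoped Matrix.Norms.Frobenius

/-- Every column of `D` has Euclidean norm one. -/
def UnitColumns {ρ κ : Type*} [Fintype ρ] (D : Matrix ρ κ ℝ) : Prop :=
  ∀ j, ‖WithLp.toLp 2 (fun i => D i j)‖ = 1

/-- The set of Kronecker-structured dictionaries `A ⊗ B` with unit-norm columns, where `A` is
`m₁ × p₁` and `B` is `m₂ × p₂`. Rows of `A ⊗ B` are indexed by `Fin m₁ × Fin m₂` and columns by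
`Fin p₁ × Fin p₂`. -/
def dictionaries (m₁ m₂ p₁ p₂ : ℕ) : Set (Matrix (Fin m₁ × Fin m₂) (Fin p₁ × Fin p₂) ℝ) :=
  {D | UnitColumns D ∧
    ∃ (A : Matrix (Fin m₁) (Fin p₁) ℝ) (B : Matrix (Fin m₂) (Fin p₂) ℝ), D = A ⊗ₖ B}

/-- The local class: the dictionaries at Frobenius distance less than `r` from `D₀`. -/
def localClass {m₁ m₂ p₁ p₂ : ℕ} (D₀ : Matrix (Fin m₁ × Fin m₂) (Fin p₁ × Fin p₂) ℝ) (r : ℝ) :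
    Set (Matrix (Fin m₁ × Fin m₂) (Fin p₁ × Fin p₂) ℝ) :=
  {D | D ∈ dictionaries m₁ m₂ p₁ p₂ ∧ ‖D - D₀‖ < r}

/-- The restricted isometry property of order `s` with constant `δ`. -/
def RIP {ρ κ : Type*} [Fintype ρ] [Fintype κ] (D : Matrix ρ κ ℝ) (s : ℕ) (δ : ℝ) : Prop :=
  ∀ x : κ → ℝ, (Function.support x).ncard ≤ s →
    (1 - δ) * ‖WithLp.toLp 2 x‖ ^ 2 ≤ ‖WithLp.toLp 2 (D *ᵥ x)‖ ^ 2 ∧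
      ‖WithLp.toLp 2 (D *ᵥ x)‖ ^ 2 ≤ (1 + δ) * ‖WithLp.toLp 2 x‖ ^ 2

end Dictionaries

section Model

/-- `ν` is the law of a zero-mean `s`-sparse random vector `x` whose support is uniformly
distributed over the `s`-element subsets of the index set, and whose nonzero entries satisfy
`𝔼[x_S x_Sᵀ | supp x = S] = σa² I_s` for each such subset `S`. -/
structure IsSparseCoeffLaw {κ : Type*} [Fintype κ] [DecidableEq κ] (s : ℕ) (σa : ℝ)
    (ν : Measure (κ → ℝ)) : Prop where
  isProbabilityMeasure : IsProbabilityMeasure ν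
  support_uniform : ∀ S : Finset κ, S.card = s →
    ν {x | Function.support x = (S : Set κ)} = 1 / ((Fintype.card κ).choose s : ℝ≥0∞)
  memLp_two : ∀ i, MemLp (fun x : κ → ℝ => x i) 2 ν
  mean_zero : ∀ i, ∫ x, x i ∂ν = 0
  cond_second_moment : ∀ S : Finset κ, S.card = s → ∀ i ∈ S, ∀ j ∈ S,
    ∫ x, x i * x j ∂(cond ν {x | Function.support x = (S : Set κ)}) =
      if i = j then σa ^ 2 else 0

/-- The law of one observation `y = D x + n`, where `x` has law `ν` and `n`, independent of `x`,
has independent `N(0, σ²)` entries. -/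
def observationLaw {ρ κ : Type*} [Fintype ρ] [Fintype κ] (ν : Measure (κ → ℝ)) (σ : ℝ)
    (D : Matrix ρ κ ℝ) : Measure (ρ → ℝ) :=
  (ν.prod (Measure.pi fun _ : ρ => gaussianReal 0 (Real.toNNReal (σ ^ 2)))).map
    fun z => D *ᵥ z.1 + z.2

/-- The law of `N` independent observations; `Y k` is the `k`-th observation. -/
def sampleLaw {ρ κ : Type*} [Fintype ρ] [Fintype κ] (ν : Measure (κ → ℝ)) (σ : ℝ) (N : ℕ)
    (D : Matrix ρ κ ℝ) : Measure (Fin N → ρ → ℝ) :=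
  Measure.pi fun _ => observationLaw ν σ D

end Model

section Risk

open scoped Matrix.Norms.Frobenius

/-- The worst-case mean squared error, in Frobenius norm, of the estimator `est` over the local
class around `D₀`. -/
def worstCaseMSE {m₁ m₂ p₁ p₂ : ℕ} (ν : Measure (Fin p₁ × Fin p₂ → ℝ)) (σ : ℝ) (N : ℕ)
    (D₀ : Matrix (Fin m₁ × Fin m₂) (Fin p₁ × Fin p₂) ℝ) (r : ℝ)
    (est : (Fin N → Fin m₁ × Fin m₂ → ℝ) → Matrix (Fin m₁ × Fin m₂) (Fin p₁ × Fin p₂) ℝ) :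
    ℝ≥0∞ :=
  ⨆ D ∈ localClass D₀ r, ∫⁻ Y, ‖est Y - D‖ₑ ^ 2 ∂(sampleLaw ν σ N D)

/-- The minimax risk: the infimum of the worst-case mean squared error over all estimators, that
is, over all maps from the observations to matrices with measurable entries. -/
def minimaxRisk {m₁ m₂ p₁ p₂ : ℕ} (ν : Measure (Fin p₁ × Fin p₂ → ℝ)) (σ : ℝ) (N : ℕ)
    (D₀ : Matrix (Fin m₁ × Fin m₂) (Fin p₁ × Fin p₂) ℝ) (r : ℝ) : ℝ≥0∞ :=
  ⨅ (est : (Fin N → Fin m₁ × Fin m₂ → ℝ) → Matrix (Fin m₁ × Fin m₂) (Fin p₁ × Fin p₂) ℝ)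
    (_ : ∀ i j, Measurable fun Y => est Y i j), worstCaseMSE ν σ N D₀ r est

end Risk

end KSDict

end

/-! The lower bound follows from Assouad's method rather than from a packing and Fano's inequality.

Write `p = p₁ p₂`, `K = p₁ (m₁ - 1) + p₂ (m₂ - 1)` and `k = N s σa² / σ²`. Fix `η` with
`0 < η ≤ min 1 (r² / (4 p))`. Rotating every column `a` of one factor, say of `A₀`, to
`√(1 - η) a + √(η / (m₁ - 1)) ∑ ± v`, where `v` runs over an orthonormal basis of the orthogonal
complement of `a`, and keeping the other factor gives a hypercube of Kronecker dictionaries with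
unit columns inside the local class (`exists_unitColumns_hypercube`). It has `n = p₁ (m₁ - 1)`
Frobenius-orthogonal directions and half-side `τ` with `n τ² = p η`.

Given the coefficients `X`, the observations at the two ends of an edge of the hypercube are two
translates of the Gaussian noise, so that a statistic cannot estimate the corresponding sign well at
both ends (`two_point_bound`). The bound obtained is linear in the squared distance of the
translates, hence it can be averaged over `X` using only the covariance `(s / p) σa² I` of the
coefficients (`IsSparseCoeffLaw.integral_mul`, `edge_bound`). Bessel's inequality turns the
Frobenius loss into a sum of quadratic losses in the signs, and averaging over the hypercube yields
`minimaxRisk ≥ p η (1 - k η / n)` (`assouad_bound`).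

Perturbing the factor with more free parameters gives `n ≥ K / 2`, hence
`minimaxRisk ≥ p η (1 - 2 k η / K)` (`le_minimaxRisk`). If the claimed bound `T` failed, then with
`η = min (min 1 (r² / (4 p))) (4 T / (p (1 - t)))` the assumed upper bound on the risk and the
negated claim would together give `minimaxRisk ≤ p η (1 - t) / 4`. The two estimates force
`k η ≥ 3 K / 8`, while the choice of `η` gives `k η ≤ (c₁ K - 3) / 8`, which is smaller because
`c₁ < 1 / 4`. -/

namespace KSDict

/-! ### Translates of Gaussian noise -/

lemma lintegral_pi_prod {ι : Type*} [Fintype ι] {α : ι → Type*} [∀ i, MeasurableSpace (α i)]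
    (μ : ∀ i, Measure (α i)) [∀ i, IsProbabilityMeasure (μ i)] {f : ∀ i, α i → ℝ≥0∞}
    (hf : ∀ i, Measurable (f i)) :
    ∫⁻ x, ∏ i, f i (x i) ∂(Measure.pi μ) = ∏ i, ∫⁻ y, f i y ∂(μ i) := by
  have hind : iIndepFun (fun i (x : ∀ i, α i) => f i (x i)) (Measure.pi μ) :=
    iIndepFun_pi (fun i => (hf i).aemeasurable)
  rw [lintegral_prod_eq_prod_lintegral_of_indepFun Finset.univ _ hind
    (fun i => (hf i).comp (measurable_pi_apply i))]
  refine Finset.prod_congr rfl fun i _ => ?_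
  exact (measurePreserving_eval μ i).lintegral_comp (hf i)

/-- Quasi-invariance under translation passes to finite products: the density of the translated
product measure is the product of the densities. -/
lemma pi_map_add_right_eq_withDensity {ι : Type*} [Fintype ι] {α : ι → Type*}
    [∀ i, MeasurableSpace (α i)] [∀ i, Add (α i)] [∀ i, MeasurableAdd (α i)]
    (μ : ∀ i, Measure (α i)) [∀ i, IsProbabilityMeasure (μ i)] (h : ∀ i, α i)
    {f : ∀ i, α i → ℝ≥0∞} (hf : ∀ i, Measurable (f i))
    (hμ : ∀ i, (μ i).map (fun y => y + h i) = (μ i).withDensity (f i)) :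
    (Measure.pi μ).map (fun x => x + h) =
      (Measure.pi μ).withDensity fun x => ∏ i, f i (x i) := by
  have hm : ∀ i, Measurable fun y : α i => y + h i := fun i => measurable_add_const (h i)
  have (i : ι) : IsProbabilityMeasure ((μ i).map fun y => y + h i) :=
    Measure.isProbabilityMeasure_map (hm i).aemeasurable
  have hmap : (Measure.pi μ).map (fun x => x + h) =
      Measure.pi fun i => (μ i).map fun y => y + h i :=
    (Measure.pi_map_pi (hμ := fun i => inferInstance) fun i => (hm i).aemeasurable)
  rw [hmap]
  refine Measure.pi_eq fun s hs => ?_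
  rw [withDensity_apply _ (MeasurableSet.univ_pi hs),
    ← lintegral_indicator (MeasurableSet.univ_pi hs)]
  have hind : ∀ x : ∀ i, α i, (Set.univ.pi s).indicator (fun x => ∏ i, f i (x i)) x =
      ∏ i, (s i).indicator (f i) (x i) := by
    intro x
    by_cases hx : x ∈ Set.univ.pi s
    · rw [Set.indicator_of_mem hx]
      exact Finset.prod_congr rfl fun i _ =>
        (Set.indicator_of_mem (hx i (Set.mem_univ i)) (f i)).symm
    · rw [Set.indicator_of_notMem hx]
      simp only [Set.mem_univ_pi, not_forall] at hx
      obtain ⟨i, hi⟩ := hx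
      exact (Finset.prod_eq_zero (Finset.mem_univ i) (Set.indicator_of_notMem hi (f i))).symm
  simp_rw [hind]
  rw [lintegral_pi_prod μ fun i => (hf i).indicator (hs i)]
  refine Finset.prod_congr rfl fun i _ => ?_
  rw [lintegral_indicator (hs i), hμ i, withDensity_apply _ (hs i)]

/-- The density with respect to `N(0, v)` of its translate by `h`. -/
noncomputable def gaussianShiftDensity (v : ℝ≥0) (h y : ℝ) : ℝ :=
  Real.exp ((h * y - h ^ 2 / 2) / v)

lemma gaussianShiftDensity_nonneg (v : ℝ≥0) (h y : ℝ) : 0 ≤ gaussianShiftDensity v h y :=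
  (Real.exp_pos _).le

lemma measurable_gaussianShiftDensity (v : ℝ≥0) (h : ℝ) :
    Measurable (gaussianShiftDensity v h) := by
  unfold gaussianShiftDensity; fun_prop

lemma gaussianShiftDensity_mul_neg (v : ℝ≥0) (h y : ℝ) :
    gaussianShiftDensity v h y * gaussianShiftDensity v (-h) y = Real.exp (-(h ^ 2 / v)) := by
  rw [gaussianShiftDensity, gaussianShiftDensity, ← Real.exp_add]
  congr 1
  ring

lemma gaussianReal_map_add_right_eq_withDensity {v : ℝ≥0} (hv : v ≠ 0) (h : ℝ) :
    (gaussianReal 0 v).map (fun y => y + h) =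
      (gaussianReal 0 v).withDensity fun y => ENNReal.ofReal (gaussianShiftDensity v h y) := by
  have hv' : (v : ℝ) ≠ 0 := by exact_mod_cast hv
  rw [gaussianReal_map_add_const, gaussianReal_of_var_ne_zero _ hv,
    gaussianReal_of_var_ne_zero _ hv, ← withDensity_mul _ (measurable_gaussianPDF 0 v)
      (measurable_gaussianShiftDensity v h).ennreal_ofReal]
  congr 1
  ext y
  rw [Pi.mul_apply, gaussianPDF, gaussianPDF, ← ENNReal.ofReal_mul (gaussianPDFReal_nonneg 0 v y),
    gaussianPDFReal, gaussianPDFReal, gaussianShiftDensity, mul_assoc _ _ (Real.exp _),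
    ← Real.exp_add]
  congr 3
  field_simp
  ring

/-- The density, with respect to the law of `ι × ρ` independent `N(0, v)` variables, of its
translate by `h`. -/
noncomputable def noiseShiftDensity {ι ρ : Type*} [Fintype ι] [Fintype ρ] (v : ℝ≥0)
    (h y : ι → ρ → ℝ) : ℝ :=
  ∏ k, ∏ i, gaussianShiftDensity v (h k i) (y k i)

section Noise

variable {ι ρ : Type*} [Fintype ι] [Fintype ρ]

lemma noiseShiftDensity_nonneg (v : ℝ≥0) (h y : ι → ρ → ℝ) : 0 ≤ noiseShiftDensity v h y :=
  Finset.prod_nonneg fun _ _ => Finset.prod_nonneg fun _ _ => gaussianShiftDensity_nonneg _ _ _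

lemma measurable_noiseShiftDensity (v : ℝ≥0) (h : ι → ρ → ℝ) :
    Measurable (noiseShiftDensity v h) := by
  unfold noiseShiftDensity gaussianShiftDensity
  fun_prop

lemma noiseShiftDensity_mul_neg (v : ℝ≥0) (h y : ι → ρ → ℝ) :
    noiseShiftDensity v h y * noiseShiftDensity v (-h) y =
      Real.exp (-((∑ k, ∑ i, h k i ^ 2) / v)) := by
  simp_rw [noiseShiftDensity, ← Finset.prod_mul_distrib, Pi.neg_apply,
    gaussianShiftDensity_mul_neg, ← Real.exp_sum, Finset.sum_neg_distrib, Finset.sum_div]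

/-- The law of `ι × ρ` independent `N(0, v)` variables. -/
noncomputable def noiseLaw (ι ρ : Type*) [Fintype ι] [Fintype ρ] (v : ℝ≥0) :
    Measure (ι → ρ → ℝ) :=
  Measure.pi fun _ : ι => Measure.pi fun _ : ρ => gaussianReal 0 v

instance (v : ℝ≥0) : IsProbabilityMeasure (noiseLaw ι ρ v) := by
  unfold noiseLaw; infer_instance

lemma noiseLaw_map_add_right_eq_withDensity {v : ℝ≥0} (hv : v ≠ 0) (h : ι → ρ → ℝ) :
    (noiseLaw ι ρ v).map (fun y => y + h) =
      (noiseLaw ι ρ v).withDensity fun y => ENNReal.ofReal (noiseShiftDensity v h y) := by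
  have h1 (k : ι) := pi_map_add_right_eq_withDensity (fun _ : ρ => gaussianReal 0 v) (h k)
    (fun i => (measurable_gaussianShiftDensity v (h k i)).ennreal_ofReal)
    (fun i => gaussianReal_map_add_right_eq_withDensity hv (h k i))
  have h2 := pi_map_add_right_eq_withDensity
    (fun _ : ι => Measure.pi fun _ : ρ => gaussianReal 0 v) h
    (fun k => Finset.measurable_prod _ fun i _ =>
      ((measurable_gaussianShiftDensity v (h k i)).ennreal_ofReal.comp (measurable_pi_apply i)))
    h1
  rw [noiseLaw, h2]
  congr 1
  ext y
  rw [noiseShiftDensity, ENNReal.ofReal_prod_of_nonneg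
    fun _ _ => Finset.prod_nonneg fun _ _ => gaussianShiftDensity_nonneg _ _ _]
  refine Finset.prod_congr rfl fun k _ => ?_
  rw [ENNReal.ofReal_prod_of_nonneg fun _ _ => gaussianShiftDensity_nonneg _ _ _]
  rfl

lemma lintegral_noiseLaw_add_right {v : ℝ≥0} (hv : v ≠ 0) (h : ι → ρ → ℝ)
    {F : (ι → ρ → ℝ) → ℝ≥0∞} (hF : Measurable F) :
    ∫⁻ y, F (y + h) ∂noiseLaw ι ρ v =
      ∫⁻ y, ENNReal.ofReal (noiseShiftDensity v h y) * F y ∂noiseLaw ι ρ v := by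
  rw [← lintegral_map hF (measurable_add_const h), noiseLaw_map_add_right_eq_withDensity hv,
    lintegral_withDensity_eq_lintegral_mul _ (measurable_noiseShiftDensity v h).ennreal_ofReal hF]
  rfl

lemma lintegral_noiseShiftDensity {v : ℝ≥0} (hv : v ≠ 0) (h : ι → ρ → ℝ) :
    ∫⁻ y, ENNReal.ofReal (noiseShiftDensity v h y) ∂noiseLaw ι ρ v = 1 := by
  have := lintegral_noiseLaw_add_right hv h (F := fun _ => 1) measurable_const
  simpa using this.symm

/-- Two-point bound for the Gaussian shift experiment: a real statistic cannot be close to `ε`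
under the translate by `h` and close to `-ε` under the translate by `-h`. If `e` and `e'` are the
two densities, then `e * e' = exp (-‖h‖² / v)` is constant and the integrand
`(f - ε)² e + (f + ε)² e'` is at least `4 e e' / (e + e') ≥ e e' (4 - e - e')`, whose integral is
twice that constant. -/
lemma two_point_bound {v : ℝ≥0} (hv : v ≠ 0) (h : ι → ρ → ℝ) {f : (ι → ρ → ℝ) → ℝ}
    (hf : Measurable f) {ε : ℝ} (hε : ε ^ 2 = 1) :
    ENNReal.ofReal (2 * (1 - (∑ k, ∑ i, h k i ^ 2) / v)) ≤
      ∫⁻ y, ENNReal.ofReal ((f (y + h) - ε) ^ 2) ∂noiseLaw ι ρ v +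
        ∫⁻ y, ENNReal.ofReal ((f (y + -h) + ε) ^ 2) ∂noiseLaw ι ρ v := by
  set k : ℝ := Real.exp (-((∑ k, ∑ i, h k i ^ 2) / v)) with hk
  have hk0 : 0 ≤ k := (Real.exp_pos _).le
  have hle : 2 * (1 - (∑ k, ∑ i, h k i ^ 2) / v) ≤ 2 * k := by
    have := Real.add_one_le_exp (-((∑ k, ∑ i, h k i ^ 2) / v))
    linarith
  refine (ENNReal.ofReal_le_ofReal hle).trans ?_
  have hm1 : Measurable fun y => ENNReal.ofReal ((f y - ε) ^ 2) := by fun_prop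
  have hm2 : Measurable fun y => ENNReal.ofReal ((f y + ε) ^ 2) := by fun_prop
  rw [lintegral_noiseLaw_add_right hv h hm1, lintegral_noiseLaw_add_right hv (-h) hm2]
  have hd1 := (measurable_noiseShiftDensity v h).ennreal_ofReal
  have hd2 := (measurable_noiseShiftDensity v (-h)).ennreal_ofReal
  have hdm1 : Measurable fun y =>
      ENNReal.ofReal (noiseShiftDensity v h y) * ENNReal.ofReal ((f y - ε) ^ 2) := hd1.mul hm1
  have hdm2 : Measurable fun y =>
      ENNReal.ofReal (noiseShiftDensity v (-h) y) * ENNReal.ofReal ((f y + ε) ^ 2) := hd2.mul hm2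
  rw [← lintegral_add_left hdm1]
  have hdk : Measurable fun y => ENNReal.ofReal k * (ENNReal.ofReal (noiseShiftDensity v h y) +
      ENNReal.ofReal (noiseShiftDensity v (-h) y)) := (hd1.add hd2).const_mul _
  have hsum : ∫⁻ y, ENNReal.ofReal k * (ENNReal.ofReal (noiseShiftDensity v h y) +
      ENNReal.ofReal (noiseShiftDensity v (-h) y)) ∂noiseLaw ι ρ v = ENNReal.ofReal (2 * k) := by
    rw [lintegral_const_mul' _ _ ENNReal.ofReal_ne_top, lintegral_add_left hd1,
      lintegral_noiseShiftDensity hv, lintegral_noiseShiftDensity hv, one_add_one_eq_two,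
      mul_comm 2 k, ENNReal.ofReal_mul hk0, ENNReal.ofReal_ofNat]
  have hkey : ENNReal.ofReal (2 * k) + ENNReal.ofReal (2 * k) ≤
      (∫⁻ y, (ENNReal.ofReal (noiseShiftDensity v h y) * ENNReal.ofReal ((f y - ε) ^ 2) +
        ENNReal.ofReal (noiseShiftDensity v (-h) y) * ENNReal.ofReal ((f y + ε) ^ 2))
          ∂noiseLaw ι ρ v) + ENNReal.ofReal (2 * k) := by
    nth_rewrite 3 [← hsum]
    rw [← lintegral_add_right _ hdk,
      ← ENNReal.ofReal_add (by positivity) (by positivity)]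
    calc ENNReal.ofReal (2 * k + 2 * k)
        = ∫⁻ _, ENNReal.ofReal (2 * k + 2 * k) ∂noiseLaw ι ρ v := by simp
      _ ≤ _ := by
        refine lintegral_mono fun y => ?_
        have he := noiseShiftDensity_nonneg v h y
        have he' := noiseShiftDensity_nonneg v (-h) y
        have hee : noiseShiftDensity v h y * noiseShiftDensity v (-h) y = k :=
          noiseShiftDensity_mul_neg v h y
        dsimp only
        rw [← ENNReal.ofReal_mul he, ← ENNReal.ofReal_mul he', ← ENNReal.ofReal_add he he',
          ← ENNReal.ofReal_mul hk0, ← ENNReal.ofReal_add (by positivity) (by positivity),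
          ← ENNReal.ofReal_add (by positivity) (by positivity)]
        refine ENNReal.ofReal_le_ofReal ?_
        generalize noiseShiftDensity v h y = e at he hee ⊢
        generalize noiseShiftDensity v (-h) y = e' at he' hee ⊢
        -- The minimum over `x` of `(x - ε)² e + (x + ε)² e'` is `4 e e' / (e + e')`.
        have hmin : 4 * k ≤ (e + e') * (e * (f y - ε) ^ 2 + e' * (f y + ε) ^ 2) := by
          have : (e + e') * (e * (f y - ε) ^ 2 + e' * (f y + ε) ^ 2) =
              ((e + e') * f y - ε * (e - e')) ^ 2 + 4 * (e * e') * ε ^ 2 := by ring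
          rw [this, hε, hee]
          nlinarith [sq_nonneg ((e + e') * f y - ε * (e - e'))]
        have hpos : 0 < e + e' := by
          have hkpos : 0 < k := Real.exp_pos _
          rcases he.eq_or_lt with h0 | h0
          · rw [← h0, zero_mul] at hee; linarith
          · linarith
        have : 0 ≤ (e + e') * (e * (f y - ε) ^ 2 + e' * (f y + ε) ^ 2 + k * (e + e')
            - (2 * k + 2 * k)) := by
          nlinarith [mul_nonneg hk0 (sq_nonneg (e + e' - 2))]
        nlinarith [nonneg_of_mul_nonneg_right this hpos]
  exact (ENNReal.add_le_add_iff_right ENNReal.ofReal_ne_top).1 hkey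

end Noise

/-! ### The observation law and the second moments of the coefficients -/

section Model

lemma measurable_mulVec {ρ κ : Type*} [Fintype κ] (D : Matrix ρ κ ℝ) :
    Measurable fun x : κ → ℝ => D *ᵥ x :=
  measurable_pi_lambda _ fun i => by
    simp only [Matrix.mulVec, dotProduct]
    fun_prop

variable {ρ κ : Type*} [Fintype ρ] [Fintype κ]

lemma measurable_comp_add_mulVec {ρ κ : Type*} [Fintype κ] {N : ℕ} (D : Matrix ρ κ ℝ)
    {F : (Fin N → ρ → ℝ) → ℝ≥0∞} (hF : Measurable F) :
    Measurable fun z : (Fin N → κ → ℝ) × (Fin N → ρ → ℝ) => F (z.2 + fun k => D *ᵥ z.1 k) :=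
  hF.comp (measurable_snd.add (measurable_pi_lambda _ fun k =>
    (measurable_mulVec D).comp ((measurable_pi_apply k).comp measurable_fst)))

/-- Integration against the law of `N` observations, conditioning on the coefficients `X`. -/
lemma lintegral_sampleLaw (ν : Measure (κ → ℝ)) [IsProbabilityMeasure ν] (σ : ℝ) (N : ℕ)
    (D : Matrix ρ κ ℝ) {F : (Fin N → ρ → ℝ) → ℝ≥0∞} (hF : Measurable F) :
    ∫⁻ Y, F Y ∂sampleLaw ν σ N D =
      ∫⁻ X, ∫⁻ y, F (y + fun k => D *ᵥ X k) ∂noiseLaw (Fin N) ρ (Real.toNNReal (σ ^ 2))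
        ∂Measure.pi fun _ : Fin N => ν := by
  set γ : Measure (ρ → ℝ) := Measure.pi fun _ : ρ => gaussianReal 0 (Real.toNNReal (σ ^ 2))
  have hg : Measurable fun z : (κ → ℝ) × (ρ → ℝ) => D *ᵥ z.1 + z.2 :=
    ((measurable_mulVec D).comp measurable_fst).add measurable_snd
  have hprob : ∀ _ : Fin N, IsProbabilityMeasure ((ν.prod γ).map fun z => D *ᵥ z.1 + z.2) :=
    fun _ => Measure.isProbabilityMeasure_map hg.aemeasurable
  have hmap : sampleLaw ν σ N D = (Measure.pi fun _ : Fin N => ν.prod γ).map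
      fun z k => D *ᵥ (z k).1 + (z k).2 :=
    (Measure.pi_map_pi (hμ := fun _ => inferInstance)
      fun _ => hg.aemeasurable).symm
  have hG := measurable_comp_add_mulVec D hF
  have hg' : Measurable fun (z : Fin N → (κ → ℝ) × (ρ → ℝ)) k => D *ᵥ (z k).1 + (z k).2 :=
    measurable_pi_lambda _ fun k => hg.comp (measurable_pi_apply k)
  rw [hmap, lintegral_map hF hg']
  have hmp := measurePreserving_arrowProdEquivProdArrow (κ → ℝ) (ρ → ℝ) (Fin N)
    (fun _ => ν) (fun _ => γ)
  rw [noiseLaw, ← lintegral_prod _ hG.aemeasurable, ← hmp.lintegral_comp hG]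
  refine lintegral_congr fun z => congrArg F (funext fun k => ?_)
  exact add_comm _ _

lemma sum_mulVec_sq (U : Matrix ρ κ ℝ) (x : κ → ℝ) :
    ∑ a, (U *ᵥ x) a ^ 2 = ∑ a, ∑ i, ∑ j, U a i * U a j * (x i * x j) := by
  refine Finset.sum_congr rfl fun a _ => ?_
  rw [sq, Matrix.mulVec, dotProduct, Finset.sum_mul_sum]
  exact Finset.sum_congr rfl fun i _ => Finset.sum_congr rfl fun j _ => by ring

variable [DecidableEq κ] {s : ℕ} {σa : ℝ} {ν : Measure (κ → ℝ)}

lemma measurableSet_support_eq (S : Finset κ) :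
    MeasurableSet {x : κ → ℝ | Function.support x = (S : Set κ)} := by
  have : {x : κ → ℝ | Function.support x = (S : Set κ)} =
      ⋂ i, {x : κ → ℝ | x i ≠ 0 ↔ i ∈ S} := by
    ext x
    simp [Set.ext_iff]
  have hm (i : κ) : Measurable fun x : κ → ℝ => x i := measurable_pi_apply i
  rw [this]
  refine MeasurableSet.iInter fun i => ?_
  by_cases hi : i ∈ S
  · simp only [hi, iff_true]
    exact (hm i (measurableSet_singleton (0 : ℝ))).compl
  · simp only [hi, iff_false, not_not]
    exact hm i (measurableSet_singleton (0 : ℝ))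

lemma card_filter_mem_powersetCard_mul (i : κ) (hs : 0 < s) :
    (((Finset.univ : Finset κ).powersetCard s).filter (i ∈ ·)).card * Fintype.card κ =
      s * (Fintype.card κ).choose s := by
  have h := Finset.card_filter_powersetCard_subset {i} (Finset.univ : Finset κ) s
    (Finset.subset_univ _) (by rw [Finset.card_singleton]; exact hs)
  obtain ⟨k, rfl⟩ : ∃ k, s = k + 1 := ⟨s - 1, by omega⟩
  obtain ⟨n, hn⟩ : ∃ n, Fintype.card κ = n + 1 :=
    ⟨Fintype.card κ - 1, by have := Fintype.card_pos_iff.2 ⟨i⟩; omega⟩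
  simp only [Finset.singleton_subset_iff, Finset.card_univ,
    Finset.card_singleton, hn, Nat.add_sub_cancel] at h
  rw [h, hn, mul_comm, Nat.add_one_mul_choose_eq, mul_comm]

/-- The coefficient vector is almost surely supported on exactly `s` indices. -/
lemma IsSparseCoeffLaw.ae_mem_iUnion (hν : IsSparseCoeffLaw s σa ν) (hs : s ≤ Fintype.card κ) :
    ∀ᵐ x ∂ν, x ∈ ⋃ S ∈ (Finset.univ : Finset κ).powersetCard s,
      {x : κ → ℝ | Function.support x = (S : Set κ)} := by
  have := hν.isProbabilityMeasure
  have hC : ((Fintype.card κ).choose s : ℝ≥0∞) ≠ 0 := by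
    exact_mod_cast (Nat.choose_pos hs).ne'
  refine (prob_compl_eq_zero_iff (Finset.measurableSet_biUnion _
    fun S _ => measurableSet_support_eq S)).2 ?_
  rw [measure_biUnion_finset _ fun S _ => measurableSet_support_eq S,
    Finset.sum_congr rfl fun S hS => hν.support_uniform S (Finset.mem_powersetCard_univ.1 hS),
    Finset.sum_const, Finset.card_powersetCard, Finset.card_univ, nsmul_eq_mul, one_div,
    ENNReal.mul_inv_cancel hC (ENNReal.natCast_ne_top _)]
  intro S _ T _ hST
  refine Set.disjoint_left.2 fun x hx hx' => hST ?_
  exact_mod_cast (show (S : Set κ) = T from hx.symm.trans hx')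

/-- The covariance matrix of the coefficient vector is `(s / p) σa² I`. -/
lemma IsSparseCoeffLaw.integral_mul (hν : IsSparseCoeffLaw s σa ν) (hs₀ : 0 < s)
    (hs : s ≤ Fintype.card κ) (i j : κ) :
    ∫ x, x i * x j ∂ν = if i = j then s * σa ^ 2 / Fintype.card κ else 0 := by
  have := hν.isProbabilityMeasure
  have hC : ((Fintype.card κ).choose s : ℝ) ≠ 0 := by
    exact_mod_cast (Nat.choose_pos hs).ne'
  have hκ : (Fintype.card κ : ℝ) ≠ 0 := by
    have : 0 < Fintype.card κ := by omega
    positivity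
  have hint : Integrable (fun x : κ → ℝ => x i * x j) ν :=
    (hν.memLp_two i).integrable_mul (hν.memLp_two j)
  have hpiece : ∀ S ∈ (Finset.univ : Finset κ).powersetCard s,
      ∫ x in {x : κ → ℝ | Function.support x = (S : Set κ)}, x i * x j ∂ν =
        if i ∈ S then (if i = j then σa ^ 2 / (Fintype.card κ).choose s else 0) else 0 := by
    intro S hS
    have hcard := Finset.mem_powersetCard_univ.1 hS
    by_cases hij : i ∈ S ∧ j ∈ S
    · have h := hν.cond_second_moment S hcard i hij.1 j hij.2
      rw [ProbabilityTheory.cond, integral_smul_measure, hν.support_uniform S hcard,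
        smul_eq_mul] at h
      simp only [one_div, inv_inv, ENNReal.toReal_natCast] at h
      rw [if_pos hij.1]
      split_ifs at h ⊢ with hij'
      · rw [eq_div_iff hC, mul_comm, h]
      · exact (mul_eq_zero.1 h).resolve_left hC
    · rw [setIntegral_eq_zero_of_forall_eq_zero]
      · split_ifs with h1 h2
        · subst h2; exact absurd ⟨h1, h1⟩ hij
        · rfl
        · rfl
      · intro x hx
        by_contra h0
        refine hij ⟨?_, ?_⟩ <;> rw [← Finset.mem_coe, ← show Function.support x = S from hx]
        · exact left_ne_zero_of_mul h0
        · exact right_ne_zero_of_mul h0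
  rw [← Measure.restrict_eq_self_of_ae_mem (hν.ae_mem_iUnion hs),
    integral_biUnion_finset _ (fun S _ => measurableSet_support_eq S) ?_
      (fun S _ => hint.integrableOn), Finset.sum_congr rfl hpiece, ← Finset.sum_filter,
    Finset.sum_const, nsmul_eq_mul]
  · split_ifs with hij
    · have h := card_filter_mem_powersetCard_mul (s := s) i hs₀
      have h' : ((((Finset.univ : Finset κ).powersetCard s).filter (i ∈ ·)).card : ℝ) *
        Fintype.card κ = s * (Fintype.card κ).choose s := by exact_mod_cast h
      rw [mul_div_assoc', div_eq_div_iff hC hκ]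
      linear_combination σa ^ 2 * h'
    · simp
  · intro S _ T _ hST
    refine Set.disjoint_left.2 fun x hx hx' => hST ?_
    exact_mod_cast (show (S : Set κ) = T from hx.symm.trans hx')

lemma IsSparseCoeffLaw.integrable_mul (hν : IsSparseCoeffLaw s σa ν) (i j : κ) :
    Integrable (fun x : κ → ℝ => x i * x j) ν :=
  (hν.memLp_two i).integrable_mul (hν.memLp_two j)

lemma IsSparseCoeffLaw.integrable_sum_mulVec_sq (hν : IsSparseCoeffLaw s σa ν)
    (U : Matrix ρ κ ℝ) : Integrable (fun x : κ → ℝ => ∑ a, (U *ᵥ x) a ^ 2) ν := by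
  simp_rw [sum_mulVec_sq]
  exact integrable_finsetSum _ fun a _ => integrable_finsetSum _ fun i _ =>
    integrable_finsetSum _ fun j _ => (hν.integrable_mul i j).const_mul _

lemma IsSparseCoeffLaw.integral_sum_mulVec_sq (hν : IsSparseCoeffLaw s σa ν) (hs₀ : 0 < s)
    (hs : s ≤ Fintype.card κ) (U : Matrix ρ κ ℝ) :
    ∫ x, ∑ a, (U *ᵥ x) a ^ 2 ∂ν =
      s * σa ^ 2 / Fintype.card κ * ∑ a, ∑ i, U a i ^ 2 := by
  simp_rw [sum_mulVec_sq]
  rw [integral_finsetSum _ fun a _ => integrable_finsetSum _ fun i _ =>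
    integrable_finsetSum _ fun j _ => (hν.integrable_mul i j).const_mul _, Finset.mul_sum]
  refine Finset.sum_congr rfl fun a _ => ?_
  rw [integral_finsetSum _ fun i _ =>
    integrable_finsetSum _ fun j _ => (hν.integrable_mul i j).const_mul _, Finset.mul_sum]
  refine Finset.sum_congr rfl fun i _ => ?_
  rw [integral_finsetSum _ fun j _ => (hν.integrable_mul i j).const_mul _]
  simp_rw [integral_const_mul, hν.integral_mul hs₀ hs, mul_ite, mul_zero]
  rw [Finset.sum_ite_eq, if_pos (Finset.mem_univ i)]
  ring

/-- The expected squared norm of `U X`, summed over `N` independent coefficient vectors. -/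
lemma IsSparseCoeffLaw.integral_pi_sum_mulVec_sq (hν : IsSparseCoeffLaw s σa ν) (hs₀ : 0 < s)
    (hs : s ≤ Fintype.card κ) (U : Matrix ρ κ ℝ) (N : ℕ) :
    Integrable (fun X : Fin N → κ → ℝ => ∑ k, ∑ a, (U *ᵥ X k) a ^ 2)
      (Measure.pi fun _ : Fin N => ν) ∧
    ∫ X, ∑ k, ∑ a, (U *ᵥ X k) a ^ 2 ∂(Measure.pi fun _ : Fin N => ν) =
      N * (s * σa ^ 2 / Fintype.card κ * ∑ a, ∑ i, U a i ^ 2) := by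
  have := hν.isProbabilityMeasure
  have hmp (k : Fin N) := measurePreserving_eval (fun _ : Fin N => ν) k
  have hint := hν.integrable_sum_mulVec_sq U
  have hintk (k : Fin N) : Integrable (fun X : Fin N → κ → ℝ => ∑ a, (U *ᵥ X k) a ^ 2)
      (Measure.pi fun _ : Fin N => ν) := (hmp k).integrable_comp_of_integrable hint
  refine ⟨integrable_finsetSum _ fun k _ => hintk k, ?_⟩
  rw [integral_finsetSum _ fun k _ => hintk k]
  have hk (k : Fin N) : ∫ X, ∑ a, (U *ᵥ X k) a ^ 2 ∂(Measure.pi fun _ : Fin N => ν) =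
      s * σa ^ 2 / Fintype.card κ * ∑ a, ∑ i, U a i ^ 2 := by
    rw [← hν.integral_sum_mulVec_sq hs₀ hs U]
    have h := integral_map (hmp k).measurable.aemeasurable
      (f := fun x : κ → ℝ => ∑ a, (U *ᵥ x) a ^ 2) (by
        rw [(hmp k).map_eq]; exact hint.aestronglyMeasurable)
    rw [(hmp k).map_eq] at h
    exact h.symm
  simp_rw [hk]
  simp

end Model

/-! ### The Frobenius inner product -/

section Frobenius
open scoped Matrix.Norms.Frobenius

variable {ρ κ : Type*} [Fintype ρ] [Fintype κ]

lemma frobenius_norm_sq (M : Matrix ρ κ ℝ) : ‖M‖ ^ 2 = ∑ a, ∑ b, M a b ^ 2 := by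
  rw [Matrix.frobenius_norm_def, ← Real.sqrt_eq_rpow, Real.sq_sqrt (by positivity)]
  simp

/-- The Frobenius inner product of two real matrices. -/
def frobeniusInner (M M' : Matrix ρ κ ℝ) : ℝ := ∑ a, ∑ b, M a b * M' a b

lemma frobeniusInner_self (M : Matrix ρ κ ℝ) : frobeniusInner M M = ‖M‖ ^ 2 := by
  simp_rw [frobenius_norm_sq, frobeniusInner, sq]

lemma frobeniusInner_sub_left (M M' U : Matrix ρ κ ℝ) :
    frobeniusInner (M - M') U = frobeniusInner M U - frobeniusInner M' U := by
  simp [frobeniusInner, sub_mul, Finset.sum_sub_distrib]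

lemma frobeniusInner_add_left (M M' U : Matrix ρ κ ℝ) :
    frobeniusInner (M + M') U = frobeniusInner M U + frobeniusInner M' U := by
  simp [frobeniusInner, add_mul, Finset.sum_add_distrib]

lemma frobeniusInner_smul_left (c : ℝ) (M U : Matrix ρ κ ℝ) :
    frobeniusInner (c • M) U = c * frobeniusInner M U := by
  simp [frobeniusInner, Finset.mul_sum, mul_assoc]

lemma frobeniusInner_comm (M U : Matrix ρ κ ℝ) :
    frobeniusInner M U = frobeniusInner U M := by
  simp [frobeniusInner, mul_comm]

lemma frobeniusInner_sum_left {ι : Type*} (t : Finset ι) (M : ι → Matrix ρ κ ℝ)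
    (U : Matrix ρ κ ℝ) :
    frobeniusInner (∑ i ∈ t, M i) U = ∑ i ∈ t, frobeniusInner (M i) U := by
  classical
  induction t using Finset.induction_on with
  | empty => simp [frobeniusInner]
  | insert a t ha ih => rw [Finset.sum_insert ha, Finset.sum_insert ha, frobeniusInner_add_left, ih]

lemma frobeniusInner_sum_smul {ι : Type*} [Fintype ι] [DecidableEq ι] {U : ι → Matrix ρ κ ℝ}
    (hU : ∀ i j, frobeniusInner (U i) (U j) = if i = j then 1 else 0) (c : ι → ℝ) (j : ι) :
    frobeniusInner (∑ i, c i • U i) (U j) = c j := by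
  simp [frobeniusInner_sum_left, frobeniusInner_smul_left, hU]

/-- Bessel's inequality for the Frobenius inner product. -/
lemma sum_frobeniusInner_sq_le {ι : Type*} [Fintype ι] [DecidableEq ι] {U : ι → Matrix ρ κ ℝ}
    (hU : ∀ i j, frobeniusInner (U i) (U j) = if i = j then 1 else 0) (M : Matrix ρ κ ℝ) :
    ∑ i, frobeniusInner M (U i) ^ 2 ≤ ‖M‖ ^ 2 := by
  set c : ι → ℝ := fun i => frobeniusInner M (U i) with hc
  set P := ∑ i, c i • U i with hP
  have hPU (V : Matrix ρ κ ℝ) : frobeniusInner P V = ∑ i, c i * frobeniusInner V (U i) := by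
    rw [hP, frobeniusInner_sum_left]
    exact Finset.sum_congr rfl fun i _ => by rw [frobeniusInner_smul_left, frobeniusInner_comm]
  have hPP : frobeniusInner P P = ∑ i, c i ^ 2 := by
    rw [hPU]
    exact Finset.sum_congr rfl fun i _ => by rw [hP, frobeniusInner_sum_smul hU, sq]
  have hPM : frobeniusInner P M = ∑ i, c i ^ 2 := by
    rw [hPU]
    exact Finset.sum_congr rfl fun i _ => by rw [sq]
  have h0 : 0 ≤ frobeniusInner (M - P) (M - P) := by rw [frobeniusInner_self]; positivity
  rw [frobeniusInner_sub_left, frobeniusInner_comm M, frobeniusInner_comm P,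
    frobeniusInner_sub_left, frobeniusInner_sub_left, frobeniusInner_comm M P, hPP, hPM,
    frobeniusInner_self] at h0
  linarith

end Frobenius

/-! ### Assouad's bound over a hypercube of dictionaries -/

lemma ofReal_integral_le_lintegral_ofReal {α : Type*} [MeasurableSpace α] {μ : Measure α}
    {f : α → ℝ} (hf : Integrable f μ) :
    ENNReal.ofReal (∫ x, f x ∂μ) ≤ ∫⁻ x, ENNReal.ofReal (f x) ∂μ := by
  calc ENNReal.ofReal (∫ x, f x ∂μ) ≤ ENNReal.ofReal (∫ x, max (f x) 0 ∂μ) :=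
        ENNReal.ofReal_le_ofReal (integral_mono hf hf.pos_part fun _ => le_max_left _ _)
    _ = ∫⁻ x, ENNReal.ofReal (max (f x) 0) ∂μ :=
        ofReal_integral_eq_lintegral_ofReal hf.pos_part (ae_of_all _ fun _ => le_max_right _ _)
    _ = ∫⁻ x, ENNReal.ofReal (f x) ∂μ := by simp [ENNReal.ofReal_max]

section Assouad
open scoped Matrix.Norms.Frobenius

/-- The vertex of a hypercube of matrices, with centre `Dc`, directions `U i` and half-side `τ`,
that has the sign vector `w`. -/
def hypercube {ρ κ ι : Type*} [Fintype ι] (Dc : Matrix ρ κ ℝ) (U : ι → Matrix ρ κ ℝ) (τ : ℝ)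
    (w : ι → ℤˣ) : Matrix ρ κ ℝ :=
  Dc + τ • ∑ i, ((w i : ℤ) : ℝ) • U i

lemma intUnit_sq (u : ℤˣ) : ((u : ℤ) : ℝ) ^ 2 = 1 := by
  rcases Int.units_eq_one_or u with rfl | rfl <;> simp

lemma hypercube_mul_mulSingle {ρ κ ι : Type*} [Fintype ι] [DecidableEq ι] (Dc : Matrix ρ κ ℝ)
    (U : ι → Matrix ρ κ ℝ) (τ : ℝ) (w : ι → ℤˣ) (i : ι) :
    hypercube Dc U τ (w * Pi.mulSingle i (-1)) =
      hypercube Dc U τ w - (2 * (τ * ((w i : ℤ) : ℝ))) • U i := by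
  set w' : ι → ℤˣ := w * Pi.mulSingle i (-1) with hw'
  have hsum : ∑ j, ((w' j : ℤ) : ℝ) • U j =
      ∑ j, ((w j : ℤ) : ℝ) • U j - (2 * ((w i : ℤ) : ℝ)) • U i := by
    rw [eq_sub_iff_add_eq, ← Finset.add_sum_erase _ _ (Finset.mem_univ i),
      ← Finset.add_sum_erase (a := i) _ (fun j => ((w j : ℤ) : ℝ) • U j) (Finset.mem_univ i)]
    have : ∑ j ∈ Finset.univ.erase i, ((w' j : ℤ) : ℝ) • U j =
        ∑ j ∈ Finset.univ.erase i, ((w j : ℤ) : ℝ) • U j :=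
      Finset.sum_congr rfl fun j hj => by
        rw [hw', Pi.mul_apply, Pi.mulSingle_eq_of_ne (Finset.ne_of_mem_erase hj), mul_one]
    rw [this, hw', Pi.mul_apply, Pi.mulSingle_eq_same, two_mul, add_smul]
    simp
    abel
  rw [hypercube, hypercube, hsum, smul_sub, smul_smul, add_sub_assoc, mul_left_comm]

variable {m₁ m₂ p₁ p₂ N s : ℕ} {σ σa r : ℝ} {ν : Measure (Fin p₁ × Fin p₂ → ℝ)}

/-- The two vertices of an edge of the hypercube cannot be told apart: a statistic that estimates
the `i`-th sign has a total quadratic error bounded below at the ends of each edge parallel to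
`U i`. -/
lemma edge_bound (hν : IsSparseCoeffLaw s σa ν) (hs : 0 < s) (hsp : s ≤ p₁ * p₂) (hσ : 0 < σ)
    {ι : Type*} [Fintype ι] [DecidableEq ι]
    (Dc : Matrix (Fin m₁ × Fin m₂) (Fin p₁ × Fin p₂) ℝ)
    {U : ι → Matrix (Fin m₁ × Fin m₂) (Fin p₁ × Fin p₂) ℝ} (τ : ℝ)
    (hU : ∀ i j, frobeniusInner (U i) (U j) = if i = j then 1 else 0)
    {f : (Fin N → Fin m₁ × Fin m₂ → ℝ) → ℝ} (hf : Measurable f) (i : ι) (w : ι → ℤˣ) :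
    ENNReal.ofReal (2 * (1 - N * s * σa ^ 2 * τ ^ 2 / (p₁ * p₂ * σ ^ 2))) ≤
      ∫⁻ Y, ENNReal.ofReal ((f Y - ((w i : ℤ) : ℝ)) ^ 2)
        ∂sampleLaw ν σ N (hypercube Dc U τ w) +
      ∫⁻ Y, ENNReal.ofReal ((f Y + ((w i : ℤ) : ℝ)) ^ 2)
        ∂sampleLaw ν σ N (hypercube Dc U τ (w * Pi.mulSingle i (-1))) := by
  have := hν.isProbabilityMeasure
  set ε : ℝ := ((w i : ℤ) : ℝ) with hε
  have hε2 : ε ^ 2 = 1 := intUnit_sq _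
  set D := hypercube Dc U τ w - (τ * ε) • U i with hD
  have hD1 : hypercube Dc U τ w = D + (τ * ε) • U i := by rw [hD]; abel
  have hD2 : hypercube Dc U τ (w * Pi.mulSingle i (-1)) = D - (τ * ε) • U i := by
    rw [hypercube_mul_mulSingle, hD, two_mul, add_smul]; abel
  rw [hD1, hD2]
  have hv : (Real.toNNReal (σ ^ 2)) ≠ 0 := by
    rw [Ne, Real.toNNReal_eq_zero, not_le]; positivity
  have hv' : ((Real.toNNReal (σ ^ 2) : ℝ≥0) : ℝ) = σ ^ 2 := Real.coe_toNNReal _ (sq_nonneg σ)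
  have hm1 : Measurable fun Y => ENNReal.ofReal ((f Y - ε) ^ 2) := by fun_prop
  have hm2 : Measurable fun Y => ENNReal.ofReal ((f Y + ε) ^ 2) := by fun_prop
  rw [lintegral_sampleLaw ν σ N _ hm1, lintegral_sampleLaw ν σ N _ hm2, ← lintegral_add_left
    (measurable_comp_add_mulVec (D + (τ * ε) • U i) hm1).lintegral_prod_right']
  have hcard : (Fintype.card (Fin p₁ × Fin p₂) : ℝ) = p₁ * p₂ := by simp
  obtain ⟨hint, hval⟩ := hν.integral_pi_sum_mulVec_sq hs (by simpa using hsp) (U i) N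
  have hUi : ∑ a, ∑ b, U i a b ^ 2 = 1 := by
    have := hU i i
    rw [if_pos rfl] at this
    simpa [frobeniusInner, sq] using this
  rw [hUi, hcard] at hval
  have hint' : Integrable (fun X : Fin N → Fin p₁ × Fin p₂ → ℝ =>
      2 * (1 - τ ^ 2 / σ ^ 2 * ∑ k, ∑ a, (U i *ᵥ X k) a ^ 2)) (Measure.pi fun _ : Fin N => ν) :=
    ((integrable_const _).sub (hint.const_mul _)).const_mul _
  have hval' : ∫ X : Fin N → Fin p₁ × Fin p₂ → ℝ,
      2 * (1 - τ ^ 2 / σ ^ 2 * ∑ k, ∑ a, (U i *ᵥ X k) a ^ 2) ∂(Measure.pi fun _ : Fin N => ν) =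
      2 * (1 - N * s * σa ^ 2 * τ ^ 2 / (p₁ * p₂ * σ ^ 2)) := by
    rw [integral_const_mul, integral_sub (integrable_const _) (hint.const_mul _),
      integral_const_mul, hval]
    simp only [integral_const, probReal_univ, smul_eq_mul, mul_one]
    congr 2
    field_simp
  rw [← hval']
  refine (ofReal_integral_le_lintegral_ofReal hint').trans (lintegral_mono fun X => ?_)
  -- Given `X`, the two observation laws are translates of the noise around the midpoint `D X`.
  have h := two_point_bound hv (fun k => (τ * ε) • (U i *ᵥ X k))
    (f := fun y => f (y + fun k => D *ᵥ X k)) (by fun_prop) hε2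
  have hq : (∑ k, ∑ a, ((τ * ε) • (U i *ᵥ X k)) a ^ 2) / ((Real.toNNReal (σ ^ 2) : ℝ≥0) : ℝ) =
      τ ^ 2 / σ ^ 2 * ∑ k, ∑ a, (U i *ᵥ X k) a ^ 2 := by
    simp_rw [Pi.smul_apply, smul_eq_mul, mul_pow, hε2, mul_one, ← Finset.mul_sum, hv']
    ring
  rw [hq] at h
  refine h.trans (le_of_eq ?_)
  congr 1
  · refine lintegral_congr fun y => ?_
    have : (y + fun k => (τ * ε) • (U i *ᵥ X k)) + (fun k => D *ᵥ X k) =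
        y + fun k => (D + (τ * ε) • U i) *ᵥ X k := by
      ext k a
      simp [Matrix.add_mulVec, Matrix.smul_mulVec]
      ring
    rw [this]
  · refine lintegral_congr fun y => ?_
    have : (y + -fun k => (τ * ε) • (U i *ᵥ X k)) + (fun k => D *ᵥ X k) =
        y + fun k => (D - (τ * ε) • U i) *ᵥ X k := by
      ext k a
      simp [Matrix.sub_mulVec, Matrix.smul_mulVec]
      ring
    rw [this]

/-- Assouad's bound: if the local class contains a hypercube of half-side `τ` with `n` orthonormal
directions, then the minimax risk is at least `n τ² (1 - N s σa² τ² / (p σ²))`. By Bessel's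
inequality the loss dominates `τ²` times the sum of the squared errors in the `n` signs, and each
of these errors, averaged over the hypercube, is bounded below edge by edge. -/
theorem assouad_bound (hν : IsSparseCoeffLaw s σa ν) (hs : 0 < s) (hsp : s ≤ p₁ * p₂)
    (hσ : 0 < σ) (D₀ : Matrix (Fin m₁ × Fin m₂) (Fin p₁ × Fin p₂) ℝ)
    {ι : Type*} [Fintype ι] [DecidableEq ι]
    (Dc : Matrix (Fin m₁ × Fin m₂) (Fin p₁ × Fin p₂) ℝ)
    {U : ι → Matrix (Fin m₁ × Fin m₂) (Fin p₁ × Fin p₂) ℝ} {τ : ℝ} (hτ : τ ≠ 0)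
    (hU : ∀ i j, frobeniusInner (U i) (U j) = if i = j then 1 else 0)
    (hmem : ∀ w, hypercube Dc U τ w ∈ localClass D₀ r) :
    ENNReal.ofReal (Fintype.card ι * τ ^ 2 *
        (1 - N * s * σa ^ 2 * τ ^ 2 / (p₁ * p₂ * σ ^ 2))) ≤
      minimaxRisk ν σ N D₀ r := by
  refine le_iInf₂ fun est hest => ?_
  set q : ℝ := 1 - N * s * σa ^ 2 * τ ^ 2 / (p₁ * p₂ * σ ^ 2) with hq
  set R := worstCaseMSE ν σ N D₀ r est
  -- `c i Y` estimates the `i`-th sign.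
  set c : ι → (Fin N → Fin m₁ × Fin m₂ → ℝ) → ℝ :=
    fun i Y => frobeniusInner (est Y - Dc) (U i) / τ with hc
  have hcm (i : ι) : Measurable (c i) := by
    refine Measurable.div_const (Finset.measurable_sum _ fun a _ =>
      Finset.measurable_sum _ fun b _ => ?_) _
    exact ((hest a b).sub_const _).mul_const _
  set g : ι → (ι → ℤˣ) → ℝ≥0∞ := fun i w =>
    ∫⁻ Y, ENNReal.ofReal ((c i Y - ((w i : ℤ) : ℝ)) ^ 2) ∂sampleLaw ν σ N (hypercube Dc U τ w)
    with hg
  have hloss (w : ι → ℤˣ) : ∑ i, ENNReal.ofReal (τ ^ 2) * g i w ≤ R := by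
    refine le_trans ?_ (le_iSup₂ (f := fun D (_ : D ∈ localClass D₀ r) =>
      ∫⁻ Y, ‖est Y - D‖ₑ ^ 2 ∂sampleLaw ν σ N D) _ (hmem w))
    have hmeas (i : ι) : Measurable fun Y =>
        ENNReal.ofReal ((c i Y - ((w i : ℤ) : ℝ)) ^ 2) := by
      have := hcm i
      fun_prop
    simp_rw [hg, ← lintegral_const_mul _ (hmeas _)]
    rw [← lintegral_finsetSum _ fun i _ => (hmeas i).const_mul _]
    refine lintegral_mono fun Y => ?_
    simp_rw [← ENNReal.ofReal_mul (sq_nonneg τ)]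
    rw [← ENNReal.ofReal_sum_of_nonneg fun i _ => by positivity, ← ofReal_norm,
      ← ENNReal.ofReal_pow (norm_nonneg _)]
    refine ENNReal.ofReal_le_ofReal (le_trans (le_of_eq ?_) (sum_frobeniusInner_sq_le hU _))
    refine Finset.sum_congr rfl fun i _ => ?_
    rw [← mul_pow, hypercube, ← sub_sub, frobeniusInner_sub_left, frobeniusInner_smul_left,
      frobeniusInner_sum_smul hU, hc]
    field_simp
  have hedge (i : ι) : (Fintype.card (ι → ℤˣ) : ℝ≥0∞) * ENNReal.ofReal (2 * q) ≤
      2 * ∑ w, g i w := by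
    have hflip : ∑ w, g i (w * Pi.mulSingle i (-1)) = ∑ w, g i w :=
      Equiv.sum_comp (Equiv.mulRight (Pi.mulSingle i (-1))) (g i)
    rw [two_mul (∑ w, g i w)]
    nth_rewrite 2 [← hflip]
    rw [← Finset.sum_add_distrib, ← nsmul_eq_mul, ← Finset.card_univ, ← Finset.sum_const]
    refine Finset.sum_le_sum fun w _ => ?_
    refine (edge_bound hν hs hsp hσ Dc τ hU (hcm i) i w).trans (le_of_eq ?_)
    simp [hg]
  set W : ℝ≥0∞ := (Fintype.card (ι → ℤˣ) : ℝ≥0∞) with hW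
  have hW0 : W ≠ 0 := by simp [hW]
  have hWtop : W ≠ ⊤ := ENNReal.natCast_ne_top _
  have htotal : 2 * W * ENNReal.ofReal (Fintype.card ι * τ ^ 2 * q) ≤ 2 * W * R := by
    calc 2 * W * ENNReal.ofReal (Fintype.card ι * τ ^ 2 * q)
        = ∑ _i : ι, ENNReal.ofReal (τ ^ 2) * (W * ENNReal.ofReal (2 * q)) := by
          rw [Finset.sum_const, Finset.card_univ, nsmul_eq_mul, mul_assoc,
            ENNReal.ofReal_mul (by positivity),
            ENNReal.ofReal_mul (Nat.cast_nonneg _), ENNReal.ofReal_natCast,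
            ENNReal.ofReal_mul zero_le_two,
            ENNReal.ofReal_ofNat]
          ring
      _ ≤ ∑ i, ENNReal.ofReal (τ ^ 2) * (2 * ∑ w, g i w) :=
          Finset.sum_le_sum fun i _ => mul_le_mul_right (hedge i) _
      _ = 2 * ∑ w, ∑ i, ENNReal.ofReal (τ ^ 2) * g i w := by
          rw [Finset.sum_comm, Finset.mul_sum]
          exact Finset.sum_congr rfl fun i _ => by rw [← Finset.mul_sum]; ring
      _ ≤ 2 * ∑ _w : ι → ℤˣ, R := by gcongr with w; exact hloss w
      _ = 2 * W * R := by
          rw [Finset.sum_const, Finset.card_univ, nsmul_eq_mul, mul_assoc]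
  exact (ENNReal.mul_le_mul_iff_right (by simp [hW0]) (by finiteness)).1 htotal

end Assouad

/-! ### Hypercubes of matrices with unit columns -/

section Perturbation

open scoped Matrix.Norms.Frobenius

lemma unitColumns_iff {ρ κ : Type*} [Fintype ρ] (D : Matrix ρ κ ℝ) :
    UnitColumns D ↔ ∀ j, ∑ i, D i j ^ 2 = 1 := by
  refine forall_congr' fun j => ?_
  rw [← sq_eq_sq₀ (norm_nonneg _) zero_le_one, EuclideanSpace.norm_sq_eq, one_pow]
  simp

lemma UnitColumns.norm_sq {ρ κ : Type*} [Fintype ρ] [Fintype κ] {D : Matrix ρ κ ℝ}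
    (hD : UnitColumns D) : ‖D‖ ^ 2 = Fintype.card κ := by
  rw [frobenius_norm_sq, Finset.sum_comm, Finset.sum_congr rfl fun j _ =>
    (unitColumns_iff D).1 hD j]
  simp

lemma exists_orthonormal_complement {n : ℕ} (a : Fin (n + 1) → ℝ) (ha : ∑ i, a i ^ 2 = 1) :
    ∃ v : Fin n → Fin (n + 1) → ℝ,
      (∀ k l, ∑ i, v k i * v l i = if k = l then 1 else 0) ∧ ∀ k, ∑ i, a i * v k i = 0 := by
  set e : Fin (n + 1) → EuclideanSpace ℝ (Fin (n + 1)) := fun _ => WithLp.toLp 2 a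
  have hnorm : ‖(WithLp.toLp 2 a : EuclideanSpace ℝ (Fin (n + 1)))‖ = 1 := by
    rw [← sq_eq_sq₀ (norm_nonneg _) zero_le_one, EuclideanSpace.norm_sq_eq, one_pow]
    simpa using ha
  have he : Orthonormal ℝ (({0} : Set (Fin (n + 1))).domRestrict e) :=
    ⟨fun _ => hnorm, fun i j hij => absurd (Subsingleton.elim i j) hij⟩
  obtain ⟨b, hb⟩ := he.exists_orthonormalBasis_extension_of_card_eq (by simp)
  have hinner (i j : Fin (n + 1)) : ∑ k, b i k * b j k = if i = j then 1 else 0 := by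
    rw [← orthonormal_iff_ite.1 b.orthonormal i j, PiLp.inner_apply]
    exact Finset.sum_congr rfl fun k _ => by simp [mul_comm]
  refine ⟨fun k i => b k.succ i, fun k l => by simpa using hinner k.succ l.succ, fun k => ?_⟩
  have h := hinner 0 k.succ
  rw [hb 0 rfl, if_neg (Fin.succ_ne_zero k).symm] at h
  exact h

lemma one_sub_sqrt_one_sub_le {η : ℝ} (h0 : 0 ≤ η) (h1 : η ≤ 1) : 1 - √(1 - η) ≤ η := by
  have : 1 - η ≤ √(1 - η) := Real.le_sqrt_of_sq_le (by nlinarith)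
  linarith

/-- Around a matrix with unit columns there is a hypercube of matrices with unit columns: each
column `a` is replaced by `√(1 - η) a + √(η / n) ∑ k, ± v k`, where `v` is an orthonormal basis of
the orthogonal complement of `a`. -/
lemma exists_unitColumns_hypercube {n p : ℕ} (hn : 0 < n) {A₀ : Matrix (Fin (n + 1)) (Fin p) ℝ}
    (hA₀ : UnitColumns A₀) {η : ℝ} (h0 : 0 ≤ η) (h1 : η ≤ 1) :
    ∃ V : Fin p × Fin n → Matrix (Fin (n + 1)) (Fin p) ℝ,
      (∀ i j, frobeniusInner (V i) (V j) = if i = j then 1 else 0) ∧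
      ∀ w, UnitColumns (hypercube (√(1 - η) • A₀) V (√(η / n)) w) ∧
        ‖hypercube (√(1 - η) • A₀) V (√(η / n)) w - A₀‖ ^ 2 ≤ 2 * p * η := by
  have hcol := (unitColumns_iff A₀).1 hA₀
  choose v hv hav using fun j => exists_orthonormal_complement (fun i => A₀ i j) (hcol j)
  have hα : √(1 - η) ^ 2 = 1 - η := Real.sq_sqrt (by linarith)
  have hβ : √(η / n) ^ 2 = η / n := Real.sq_sqrt (by positivity)
  have hβn : √(η / n) ^ 2 * n = η := by
    rw [hβ]; field_simp
  -- The matrix with the single nonzero column `v j k`, in position `j`.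
  set V : Fin p × Fin n → Matrix (Fin (n + 1)) (Fin p) ℝ :=
    fun jk => Matrix.of fun i j => if j = jk.1 then v jk.1 jk.2 i else 0
  have hV (jk i j) : V jk i j = if j = jk.1 then v jk.1 jk.2 i else 0 := rfl
  have hent (c : ℝ) (w : Fin p × Fin n → ℤˣ) (i : Fin (n + 1)) (j : Fin p) :
      hypercube (c • A₀) V (√(η / n)) w i j =
        c * A₀ i j + √(η / n) * ∑ k, ((w (j, k) : ℤ) : ℝ) * v j k i := by
    simp only [hypercube, Matrix.add_apply, Matrix.smul_apply, Matrix.sum_apply, smul_eq_mul,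
      Fintype.sum_prod_type, hV, mul_ite, mul_zero]
    congr 2
    rw [Finset.sum_eq_single j (fun j' _ hj' => by simp [hj'.symm]) (by simp)]
    simp
  -- The squared norm of a column of any such combination, by orthonormality.
  have hsq (c : ℝ) (w : Fin p × Fin n → ℤˣ) (j : Fin p) :
      ∑ i, hypercube (c • A₀) V (√(η / n)) w i j ^ 2 = c ^ 2 + η := by
    have hS : ∑ i, (∑ k, ((w (j, k) : ℤ) : ℝ) * v j k i) ^ 2 = n := by
      calc ∑ i, (∑ k, ((w (j, k) : ℤ) : ℝ) * v j k i) ^ 2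
          = ∑ i, ∑ k, ∑ l, ((w (j, k) : ℤ) : ℝ) * ((w (j, l) : ℤ) : ℝ) * (v j k i * v j l i) := by
            refine Finset.sum_congr rfl fun i _ => ?_
            rw [sq, Finset.sum_mul_sum]
            exact Finset.sum_congr rfl fun k _ => Finset.sum_congr rfl fun l _ => by ring
        _ = ∑ k, ∑ l, ((w (j, k) : ℤ) : ℝ) * ((w (j, l) : ℤ) : ℝ) * ∑ i, v j k i * v j l i := by
            rw [Finset.sum_comm]
            refine Finset.sum_congr rfl fun k _ => ?_
            rw [Finset.sum_comm]
            exact Finset.sum_congr rfl fun l _ => (Finset.mul_sum _ _ _).symm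
        _ = ∑ _k : Fin n, (1 : ℝ) := by
            refine Finset.sum_congr rfl fun k _ => ?_
            simp_rw [hv, mul_ite, mul_one, mul_zero]
            rw [Finset.sum_ite_eq, if_pos (Finset.mem_univ k), ← sq, intUnit_sq]
        _ = n := by simp
    have hX : ∑ i, A₀ i j * ∑ k, ((w (j, k) : ℤ) : ℝ) * v j k i = 0 := by
      simp_rw [Finset.mul_sum]
      rw [Finset.sum_comm]
      refine Finset.sum_eq_zero fun k _ => ?_
      have : ∑ i, A₀ i j * (((w (j, k) : ℤ) : ℝ) * v j k i) =
          ((w (j, k) : ℤ) : ℝ) * ∑ i, A₀ i j * v j k i := by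
        rw [Finset.mul_sum]; exact Finset.sum_congr rfl fun i _ => by ring
      rw [this, hav, mul_zero]
    have hexp : ∀ i, hypercube (c • A₀) V (√(η / n)) w i j ^ 2 = c ^ 2 * A₀ i j ^ 2 +
        2 * c * √(η / n) * (A₀ i j * ∑ k, ((w (j, k) : ℤ) : ℝ) * v j k i) +
        √(η / n) ^ 2 * (∑ k, ((w (j, k) : ℤ) : ℝ) * v j k i) ^ 2 := fun i => by
      rw [hent]; ring
    simp_rw [hexp]
    rw [Finset.sum_add_distrib, Finset.sum_add_distrib, ← Finset.mul_sum, ← Finset.mul_sum,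
      ← Finset.mul_sum, hcol, hX, hS, hβn]
    ring
  refine ⟨V, ?_, fun w => ⟨(unitColumns_iff _).2 fun j => ?_, ?_⟩⟩
  · rintro ⟨j, k⟩ ⟨j', k'⟩
    rw [frobeniusInner, Finset.sum_comm]
    simp only [hV, Prod.mk.injEq]
    by_cases hj : j = j'
    · subst hj
      rw [Finset.sum_eq_single j (fun b _ hb => by simp [hb]) (by simp)]
      simpa using hv j k k'
    · rw [if_neg fun h => hj h.1]
      refine Finset.sum_eq_zero fun b _ => Finset.sum_eq_zero fun i _ => ?_
      by_cases hb : b = j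
      · subst hb; simp [hj]
      · simp [hb]
  · rw [hsq, hα]; ring
  · have hdiff : hypercube (√(1 - η) • A₀) V (√(η / n)) w - A₀ =
        hypercube ((√(1 - η) - 1) • A₀) V (√(η / n)) w := by
      rw [hypercube, hypercube, sub_smul, one_smul]; abel
    rw [hdiff, frobenius_norm_sq, Finset.sum_comm, Finset.sum_congr rfl fun j _ => hsq _ w j]
    have h := one_sub_sqrt_one_sub_le h0 h1
    have hcol2 : (√(1 - η) - 1) ^ 2 + η ≤ 2 * η := by nlinarith
    calc ∑ _j : Fin p, ((√(1 - η) - 1) ^ 2 + η) ≤ ∑ _j : Fin p, 2 * η :=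
          Finset.sum_le_sum fun _ _ => hcol2
      _ = 2 * p * η := by simp; ring

end Perturbation

section Kronecker

open scoped Matrix.Norms.Frobenius

variable {ρ κ ρ' κ' : Type*} [Fintype ρ] [Fintype κ] [Fintype ρ'] [Fintype κ']

lemma frobeniusInner_kronecker (A A' : Matrix ρ κ ℝ) (B B' : Matrix ρ' κ' ℝ) :
    frobeniusInner (A ⊗ₖ B) (A' ⊗ₖ B') = frobeniusInner A A' * frobeniusInner B B' := by
  simp only [frobeniusInner, Matrix.kronecker_apply, Fintype.sum_prod_type]
  rw [Finset.sum_mul_sum]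
  refine Finset.sum_congr rfl fun a _ => Finset.sum_congr rfl fun a' _ => ?_
  rw [Finset.sum_mul_sum]
  exact Finset.sum_congr rfl fun b _ => Finset.sum_congr rfl fun b' _ => by ring

lemma norm_kronecker_sq (A : Matrix ρ κ ℝ) (B : Matrix ρ' κ' ℝ) :
    ‖A ⊗ₖ B‖ ^ 2 = ‖A‖ ^ 2 * ‖B‖ ^ 2 := by
  rw [← frobeniusInner_self, frobeniusInner_kronecker, frobeniusInner_self, frobeniusInner_self]

lemma UnitColumns.kronecker {ρ κ ρ' κ' : Type*} [Fintype ρ] [Fintype ρ'] {A : Matrix ρ κ ℝ}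
    {B : Matrix ρ' κ' ℝ} (hA : UnitColumns A) (hB : UnitColumns B) : UnitColumns (A ⊗ₖ B) := by
  rw [unitColumns_iff] at *
  rintro ⟨j, j'⟩
  simp only [Matrix.kronecker_apply, Fintype.sum_prod_type, mul_pow]
  rw [← Finset.sum_mul_sum, hA, hB, one_mul]

end Kronecker

/-! ### Perturbing a Kronecker factor -/

section KroneckerPerturbation

open scoped Matrix.Norms.Frobenius

variable {m₁ m₂ p₁ p₂ N s : ℕ} {σ σa r : ℝ} {ν : Measure (Fin p₁ × Fin p₂ → ℝ)}

/-- Tensoring a hypercube with a fixed matrix `B`. The factor `c` will be the norm of `B`, so that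
the new directions are again normalized. -/
lemma hypercube_kronecker {ρ κ ρ' κ' ι : Type*} [Fintype ι] (D : Matrix ρ κ ℝ)
    (V : ι → Matrix ρ κ ℝ) (β : ℝ) (B : Matrix ρ' κ' ℝ) {c : ℝ} (hc : c ≠ 0) (w : ι → ℤˣ) :
    hypercube (D ⊗ₖ B) (fun i => c⁻¹ • (V i ⊗ₖ B)) (β * c) w = hypercube D V β w ⊗ₖ B := by
  ext ⟨a, a'⟩ ⟨b, b'⟩
  simp only [hypercube, Matrix.add_apply, Matrix.smul_apply, Matrix.sum_apply, smul_eq_mul,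
    Matrix.kronecker_apply, add_mul, mul_assoc, Finset.sum_mul, Finset.mul_sum]
  congr 1
  refine Finset.sum_congr rfl fun i _ => ?_
  field_simp

lemma kronecker_hypercube {ρ κ ρ' κ' ι : Type*} [Fintype ι] (D : Matrix ρ κ ℝ)
    (V : ι → Matrix ρ κ ℝ) (β : ℝ) (B : Matrix ρ' κ' ℝ) {c : ℝ} (hc : c ≠ 0) (w : ι → ℤˣ) :
    hypercube (B ⊗ₖ D) (fun i => c⁻¹ • (B ⊗ₖ V i)) (β * c) w = B ⊗ₖ hypercube D V β w := by
  ext ⟨a, a'⟩ ⟨b, b'⟩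
  simp only [hypercube, Matrix.add_apply, Matrix.smul_apply, Matrix.sum_apply, smul_eq_mul,
    Matrix.kronecker_apply, mul_add, Finset.mul_sum]
  congr 1
  refine Finset.sum_congr rfl fun i _ => ?_
  field_simp

lemma sub_kronecker {ρ κ ρ' κ' : Type*} (A A' : Matrix ρ κ ℝ) (B : Matrix ρ' κ' ℝ) :
    (A - A') ⊗ₖ B = A ⊗ₖ B - A' ⊗ₖ B := by
  ext; simp [sub_mul]

lemma kronecker_sub {ρ κ ρ' κ' : Type*} (A : Matrix ρ κ ℝ) (B B' : Matrix ρ' κ' ℝ) :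
    A ⊗ₖ (B - B') = A ⊗ₖ B - A ⊗ₖ B' := by
  ext; simp [mul_sub]

/-- The radius condition on `η`: a perturbation of squared size `2 p η q` stays inside the ball of
radius `r`, since then `2 p q η ≤ r² / 2`. -/
lemma perturbation_lt {p q η r : ℝ} (hp : 0 < p) (hq : 0 < q) (hr : 0 < r)
    (hη : η ≤ r ^ 2 / (4 * (p * q))) {x : ℝ} (hx : x ^ 2 ≤ 2 * p * η * q) : x < r := by
  have h : η * (4 * (p * q)) ≤ r ^ 2 := (le_div_iff₀ (by positivity)).1 hη
  nlinarith [sq_nonneg (x - r), sq_nonneg (x + r), mul_pos hr hr]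

/-- The minimax bound obtained by perturbing the first factor of the reference dictionary. -/
theorem le_minimaxRisk_of_left {n : ℕ} (hn : 0 < n) (hν : IsSparseCoeffLaw s σa ν) (hs : 0 < s)
    (hsp : s ≤ p₁ * p₂) (hσ : 0 < σ) (hr : 0 < r) {A₀ : Matrix (Fin (n + 1)) (Fin p₁) ℝ}
    {B₀ : Matrix (Fin m₂) (Fin p₂) ℝ} (hA₀ : UnitColumns A₀) (hB₀ : UnitColumns B₀) {η : ℝ}
    (h0 : 0 < η) (h1 : η ≤ 1) (h2 : η ≤ r ^ 2 / (4 * ((p₁ : ℝ) * p₂))) :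
    ENNReal.ofReal (p₁ * p₂ * η * (1 - N * s * σa ^ 2 * η / (σ ^ 2 * (p₁ * n)))) ≤
      minimaxRisk ν σ N (A₀ ⊗ₖ B₀) r := by
  have hp : 0 < p₁ * p₂ := hs.trans_le hsp
  have hp₁ : (0 : ℝ) < p₁ := by exact_mod_cast Nat.pos_of_mul_pos_right hp
  have hp₂ : (0 : ℝ) < p₂ := by exact_mod_cast Nat.pos_of_mul_pos_left hp
  have hn' : (0 : ℝ) < n := by exact_mod_cast hn
  obtain ⟨V, hV, hmem⟩ := exists_unitColumns_hypercube hn hA₀ h0.le h1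
  have hB : ‖B₀‖ ^ 2 = p₂ := by simpa using hB₀.norm_sq
  have hc : √(p₂ : ℝ) ≠ 0 := (Real.sqrt_pos.2 hp₂).ne'
  have hc2 : √(p₂ : ℝ) ^ 2 = p₂ := Real.sq_sqrt hp₂.le
  have hcc : (√(p₂ : ℝ))⁻¹ * ((√(p₂ : ℝ))⁻¹ * p₂) = 1 := by
    rw [← mul_assoc, ← mul_inv, Real.mul_self_sqrt hp₂.le, inv_mul_cancel₀ hp₂.ne']
  have hβ : √(η / n) ^ 2 = η / n := Real.sq_sqrt (by positivity)
  have hβ0 : √(η / n) ≠ 0 := (Real.sqrt_pos.2 (by positivity)).ne'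
  have h := assouad_bound (N := N) (r := r) hν hs hsp hσ (A₀ ⊗ₖ B₀)
    ((√(1 - η) • A₀) ⊗ₖ B₀) (U := fun i => (√(p₂ : ℝ))⁻¹ • (V i ⊗ₖ B₀))
    (τ := √(η / n) * √(p₂ : ℝ)) (mul_ne_zero hβ0 hc) (fun i j => ?_) (fun w => ?_)
  · refine le_trans (le_of_eq (congrArg ENNReal.ofReal ?_)) h
    rw [mul_pow, hβ, hc2]
    simp only [Fintype.card_prod, Fintype.card_fin, Nat.cast_mul]
    field_simp
  · rw [frobeniusInner_smul_left, frobeniusInner_comm, frobeniusInner_smul_left,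
      frobeniusInner_kronecker, frobeniusInner_self, hB, frobeniusInner_comm, hV]
    split_ifs
    · rwa [one_mul]
    · simp
  · rw [hypercube_kronecker _ _ _ _ hc]
    obtain ⟨hunit, hdist⟩ := hmem w
    refine ⟨⟨hunit.kronecker hB₀, _, _, rfl⟩, perturbation_lt hp₁ hp₂ hr h2 ?_⟩
    rw [← sub_kronecker, norm_kronecker_sq, hB]
    exact mul_le_mul_of_nonneg_right hdist hp₂.le

/-- The minimax bound obtained by perturbing the second factor of the reference dictionary. -/
theorem le_minimaxRisk_of_right {n : ℕ} (hn : 0 < n) (hν : IsSparseCoeffLaw s σa ν) (hs : 0 < s)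
    (hsp : s ≤ p₁ * p₂) (hσ : 0 < σ) (hr : 0 < r) {A₀ : Matrix (Fin m₁) (Fin p₁) ℝ}
    {B₀ : Matrix (Fin (n + 1)) (Fin p₂) ℝ} (hA₀ : UnitColumns A₀) (hB₀ : UnitColumns B₀) {η : ℝ}
    (h0 : 0 < η) (h1 : η ≤ 1) (h2 : η ≤ r ^ 2 / (4 * ((p₁ : ℝ) * p₂))) :
    ENNReal.ofReal (p₁ * p₂ * η * (1 - N * s * σa ^ 2 * η / (σ ^ 2 * (p₂ * n)))) ≤
      minimaxRisk ν σ N (A₀ ⊗ₖ B₀) r := by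
  have hp : 0 < p₁ * p₂ := hs.trans_le hsp
  have hp₁ : (0 : ℝ) < p₁ := by exact_mod_cast Nat.pos_of_mul_pos_right hp
  have hp₂ : (0 : ℝ) < p₂ := by exact_mod_cast Nat.pos_of_mul_pos_left hp
  have hn' : (0 : ℝ) < n := by exact_mod_cast hn
  obtain ⟨V, hV, hmem⟩ := exists_unitColumns_hypercube hn hB₀ h0.le h1
  have hA : ‖A₀‖ ^ 2 = p₁ := by simpa using hA₀.norm_sq
  have hc : √(p₁ : ℝ) ≠ 0 := (Real.sqrt_pos.2 hp₁).ne'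
  have hc2 : √(p₁ : ℝ) ^ 2 = p₁ := Real.sq_sqrt hp₁.le
  have hcc : (√(p₁ : ℝ))⁻¹ * ((√(p₁ : ℝ))⁻¹ * p₁) = 1 := by
    rw [← mul_assoc, ← mul_inv, Real.mul_self_sqrt hp₁.le, inv_mul_cancel₀ hp₁.ne']
  have hβ : √(η / n) ^ 2 = η / n := Real.sq_sqrt (by positivity)
  have hβ0 : √(η / n) ≠ 0 := (Real.sqrt_pos.2 (by positivity)).ne'
  have h := assouad_bound (N := N) (r := r) hν hs hsp hσ (A₀ ⊗ₖ B₀)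
    (A₀ ⊗ₖ (√(1 - η) • B₀)) (U := fun i => (√(p₁ : ℝ))⁻¹ • (A₀ ⊗ₖ V i))
    (τ := √(η / n) * √(p₁ : ℝ)) (mul_ne_zero hβ0 hc) (fun i j => ?_) (fun w => ?_)
  · refine le_trans (le_of_eq (congrArg ENNReal.ofReal ?_)) h
    rw [mul_pow, hβ, hc2]
    simp only [Fintype.card_prod, Fintype.card_fin, Nat.cast_mul]
    field_simp
  · rw [frobeniusInner_smul_left, frobeniusInner_comm, frobeniusInner_smul_left,
      frobeniusInner_kronecker, frobeniusInner_self, hA, frobeniusInner_comm, hV]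
    split_ifs
    · rwa [mul_one]
    · simp
  · rw [kronecker_hypercube _ _ _ _ hc]
    obtain ⟨hunit, hdist⟩ := hmem w
    refine ⟨⟨hA₀.kronecker hunit, _, _, rfl⟩, perturbation_lt (η := η) hp₂ hp₁ hr ?_ ?_⟩
    · rwa [mul_comm (p₂ : ℝ)]
    rw [← kronecker_sub, norm_kronecker_sq, hA, mul_comm]
    exact mul_le_mul_of_nonneg_right hdist hp₁.le

/-- The minimax bound obtained by perturbing whichever factor has the larger number
`p_i (m_i - 1)` of free parameters, which is at least half of their sum. -/
theorem le_minimaxRisk (hν : IsSparseCoeffLaw s σa ν) (hs : 0 < s)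
    (hsp : s ≤ p₁ * p₂) (hσ : 0 < σ) (hr : 0 < r) {A₀ : Matrix (Fin m₁) (Fin p₁) ℝ}
    {B₀ : Matrix (Fin m₂) (Fin p₂) ℝ} (hA₀ : UnitColumns A₀) (hB₀ : UnitColumns B₀) {η : ℝ}
    (h0 : 0 < η) (h1 : η ≤ 1) (h2 : η ≤ r ^ 2 / (4 * ((p₁ : ℝ) * p₂)))
    (hK : 0 < p₁ * ((m₁ : ℝ) - 1) + p₂ * ((m₂ : ℝ) - 1)) :
    ENNReal.ofReal (p₁ * p₂ * η * (1 - 2 * (N * s * σa ^ 2 * η / σ ^ 2) /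
        (p₁ * ((m₁ : ℝ) - 1) + p₂ * ((m₂ : ℝ) - 1)))) ≤
      minimaxRisk ν σ N (A₀ ⊗ₖ B₀) r := by
  have hp : 0 < p₁ * p₂ := hs.trans_le hsp
  have hp₁ : (0 : ℝ) < p₁ := by exact_mod_cast Nat.pos_of_mul_pos_right hp
  have hp₂ : (0 : ℝ) < p₂ := by exact_mod_cast Nat.pos_of_mul_pos_left hp
  set K := p₁ * ((m₁ : ℝ) - 1) + p₂ * ((m₂ : ℝ) - 1) with hKdef
  have hmono {d : ℝ} (hd : K ≤ 2 * d) :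
      p₁ * p₂ * η * (1 - 2 * (N * s * σa ^ 2 * η / σ ^ 2) / K) ≤
        p₁ * p₂ * η * (1 - N * s * σa ^ 2 * η / (σ ^ 2 * d)) := by
    have hd0 : 0 < d := by linarith
    refine mul_le_mul_of_nonneg_left (sub_le_sub_left ?_ 1) (by positivity)
    rw [← div_div, div_le_div_iff₀ hd0 hK]
    have : 0 ≤ N * s * σa ^ 2 * η / σ ^ 2 := by positivity
    nlinarith
  rcases le_total (p₂ * ((m₂ : ℝ) - 1)) (p₁ * ((m₁ : ℝ) - 1)) with h | h
  · have hm : (1 : ℝ) < m₁ := by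
      by_contra hm
      nlinarith [mul_nonneg hp₁.le (sub_nonneg.2 (not_lt.1 hm))]
    obtain ⟨n, rfl⟩ : ∃ n, m₁ = n + 1 := ⟨m₁ - 1, by
      have : 1 < m₁ := by exact_mod_cast hm
      omega⟩
    push_cast at hm h hKdef
    have hn : 0 < n := by exact_mod_cast (by linarith : (0 : ℝ) < n)
    exact (ENNReal.ofReal_le_ofReal (hmono (by linarith))).trans
      (le_minimaxRisk_of_left hn hν hs hsp hσ hr hA₀ hB₀ h0 h1 h2)
  · have hm : (1 : ℝ) < m₂ := by
      by_contra hm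
      nlinarith [mul_nonneg hp₂.le (sub_nonneg.2 (not_lt.1 hm))]
    obtain ⟨n, rfl⟩ : ∃ n, m₂ = n + 1 := ⟨m₂ - 1, by
      have : 1 < m₂ := by exact_mod_cast hm
      omega⟩
    push_cast at hm h hKdef
    have hn : 0 < n := by exact_mod_cast (by linarith : (0 : ℝ) < n)
    exact (ENNReal.ofReal_le_ofReal (hmono (by linarith))).trans
      (le_minimaxRisk_of_right hn hν hs hsp hσ hr hA₀ hB₀ h0 h1 h2)

end KroneckerPerturbation

end KSDict

/-! ### The lower bound on the minimax risk -/

theorem corollary1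
    (m₁ m₂ p₁ p₂ N s : ℕ) (hN : 0 < N) (hs : 0 < s) (hsp : s ≤ p₁ * p₂)
    (σ σa r : ℝ) (hσ : 0 < σ) (hσa : 0 < σa) (hr : 0 < r)
    (A₀ : Matrix (Fin m₁) (Fin p₁) ℝ) (B₀ : Matrix (Fin m₂) (Fin p₂) ℝ)
    (hA₀ : KSDict.UnitColumns A₀) (hB₀ : KSDict.UnitColumns B₀)
    (hRIP : KSDict.RIP (A₀ ⊗ₖ B₀) s (1 / 2))
    (ν : Measure (Fin p₁ × Fin p₂ → ℝ)) (hν : KSDict.IsSparseCoeffLaw s σa ν)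
    (t c₁ : ℝ) (ht₀ : 0 < t) (ht₁ : t < 1) (hc₀ : 0 < c₁) (hc₁ : c₁ < t / (8 * Real.log 2))
    (hrisk : KSDict.minimaxRisk ν σ N (A₀ ⊗ₖ B₀) r ≤
      ENNReal.ofReal (2 * ((p₁ : ℝ) * p₂) * (1 - t) / 8 * min 1 (r ^ 2 / (4 * ((p₁ : ℝ) * p₂)))))
    (C₁ : ℝ) (hC₁ : C₁ = (1 - t) * ((p₁ : ℝ) * p₂) / (32 * r ^ 2)) :
    ENNReal.ofReal (C₁ * r ^ 2 * σ ^ 2 / (N * s * σa ^ 2) *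
        (c₁ * (p₁ * ((m₁ : ℝ) - 1) + p₂ * ((m₂ : ℝ) - 1)) - 3)) ≤
      KSDict.minimaxRisk ν σ N (A₀ ⊗ₖ B₀) r := by
  have hpn : 0 < p₁ * p₂ := hs.trans_le hsp
  have hp : (0 : ℝ) < (p₁ : ℝ) * p₂ := by exact_mod_cast hpn
  have hN' : (0 : ℝ) < N := by exact_mod_cast hN
  have hs' : (0 : ℝ) < s := by exact_mod_cast hs
  set K := p₁ * ((m₁ : ℝ) - 1) + p₂ * ((m₂ : ℝ) - 1)
  set p := (p₁ : ℝ) * p₂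
  set m := min 1 (r ^ 2 / (4 * p)) with hm
  have hm0 : 0 < m := lt_min one_pos (by positivity)
  -- The signal-to-noise ratio of the whole sample.
  set k : ℝ := N * s * σa ^ 2 / σ ^ 2 with hk
  have hk0 : 0 < k := by positivity
  set T : ℝ := C₁ * r ^ 2 * σ ^ 2 / (N * s * σa ^ 2) * (c₁ * K - 3) with hT
  have hTk : T * (32 * k) = (1 - t) * p * (c₁ * K - 3) := by
    rw [hT, hk, hC₁]; field_simp
  by_contra! hlt
  have hT0 : 0 < T := ENNReal.ofReal_pos.1 (bot_le.trans_lt hlt)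
  have h1t : 0 < 1 - t := by linarith
  have hcK : 0 < c₁ * K - 3 := by
    have : 0 < (1 - t) * p * (c₁ * K - 3) := hTk ▸ by positivity
    exact pos_of_mul_pos_right this (by positivity)
  have hK : 0 < K := pos_of_mul_pos_right (by linarith : 0 < c₁ * K) hc₀.le
  have hc₁' : c₁ < 1 / 4 := by
    have hlog : 1 / 2 < Real.log 2 := by linarith [Real.log_two_gt_d9]
    rw [lt_div_iff₀ (by positivity)] at hc₁
    nlinarith
  -- With this `η`, the smaller of the two upper bounds on the risk is `p η (1 - t) / 4`.
  set η := min m (4 * T / (p * (1 - t))) with hη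
  have hη0 : 0 < η := lt_min hm0 (by positivity)
  have hηm : η ≤ m := min_le_left _ _
  have hlow := KSDict.le_minimaxRisk (N := N) hν hs hsp hσ hr hA₀ hB₀ hη0
    (hηm.trans (min_le_left _ _)) (hηm.trans (min_le_right _ _)) hK
  have hup : KSDict.minimaxRisk ν σ N (A₀ ⊗ₖ B₀) r ≤ ENNReal.ofReal (p * η * (1 - t) / 4) := by
    rcases min_choice m (4 * T / (p * (1 - t))) with h | h
    · rw [hη, h]
      refine hrisk.trans (le_of_eq (congrArg ENNReal.ofReal ?_))
      ring
    · rw [hη, h]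
      refine hlt.le.trans (le_of_eq (congrArg ENNReal.ofReal ?_))
      field_simp
  have hle := (ENNReal.ofReal_le_ofReal_iff (by positivity)).1 (hlow.trans hup)
  have hkη : N * s * σa ^ 2 * η / σ ^ 2 = k * η := by rw [hk]; ring
  rw [hkη] at hle
  have hle' : 1 - 2 * (k * η) / K ≤ (1 - t) / 4 := by
    refine le_of_mul_le_mul_left ?_ (by positivity : 0 < p * η)
    linarith
  have hge : 3 / 8 * K ≤ k * η := by
    have : 3 / 4 ≤ 2 * (k * η) / K := by linarith
    rw [le_div_iff₀ hK] at this
    linarith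
  have hηT : η * (p * (1 - t)) ≤ 4 * T := (le_div_iff₀ (by positivity)).1 (min_le_right _ _)
  have hsmall : k * η ≤ (c₁ * K - 3) / 8 := by
    refine le_of_mul_le_mul_left ?_ (by positivity : 0 < p * (1 - t))
    have := mul_le_mul_of_nonneg_left hηT hk0.le
    linarith
  have := mul_lt_mul_of_pos_right hc₁' hK
  linarith
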